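/- Pure states are represented by nonzero vectors, not necessarily normalised; $|a\pm b\pm\cdots\rangle$ means $|a\rangle\pm|b\rangle\pm\cdots$. In $\mathbb C^6$ with basis $|0\rangle,\dots,|5\rangle$ put $$u_p=|0-4\rangle,\quad u_q=|1-5\rangle,\quad u_r=|2-3\rangle,\quad u_{\eta_\pm}=|0\pm1+4\pm5\rangle,\quad u_{\kappa_\pm}=|0\pm2+4\pm3\rangle,$$ and in $\mathbb C^3$ put $$v_p=|0\rangle,\quad v_q=|1\rangle,\quad v_r=|2\rangle,\quad v_{\eta_\pm}=\tfrac{1}{\sqrt2}(|0\rangle\pm|1\rangle),\quad v_{\kappa_\pm}=\tfrac1{\sqrt2}(|0\rangle\pm|2\rangle).$$ Let $W$ be the set of the following 27 words: $$\begin{aligned}&(p,q,\eta_\pm),\ (p,r,\kappa_\pm),\ (q,r,\eta_\pm),\ (r,q,\kappa_\pm),\\&(q,\eta_\pm,p),\ (r,\kappa_\pm,p),\ (r,\eta_\pm,q),\ (q,\kappa_\pm,r),\\&(\eta_\pm,p,q),\ (\kappa_\pm,p,r),\ (\eta_\pm,q,r),\ (\kappa_\pm,r,q),\\&(p,p,p),\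 (q,q,q),\ (r,r,r).\end{aligned}$$ Let $\mathcal G_3=\{u_a\otimes u_b\otimes u_c:(a,b,c)\in W\}\subset\mathbb C^6\otimes\mathbb C^6\otimes\mathbb C^6$, and let $\mathcal H=\{v_a\otimes v_b\otimes v_c:(a,b,c)\in W\}\subset\mathbb C^3\otimes\mathbb C^3\otimes\mathbb C^3$ be the set of Halder et al. A measurement given by operators $(M_k)$ with $\sum_kM_k^\dagger M_k=1$, acting on the joint system of a group of parties, is an orthogonality preserving measurement (OPM) on a family of states if, for each outcome $k$, the unnormalised post-measurement states are mutually orthogonal. For a given grouping of the parties, an orthogonal set of states is called locally irreducible if no finite-round protocol, in which each step is an OPM made by one of the groups (chosen depending on the earlier outcomes) on the current post-measurement states, has a branch in which some state of the set is sent to $0$ (it is eliminated) and some other state of the set is not. **Theorem 3.** The 27 vectors of $\mathcal G_3$ are nonzero and mutually orthogonal. Let each of the three parties, in any order, perform the measurement $\{K_1,K_2\}$, where $K_1,K_2$ are the orthogonal projectors of $\mathbb C^6$ onto $\mathrm{span}\{|0\rangle,|1\rangle,|2\rangle\}$ and $\mathrm{span}\{|3\rangle,|4\rangle,|5\rangle\}$.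 Each of these measurements is a local OPM on the states left by the preceding outcomes. In each of the eight outcome branches the 27 resulting states are product states; they are, up to nonzero scalar factors, the images of the corresponding states of $\mathcal H$ under $V_A\otimes V_B\otimes V_C$, where for each party $V:\mathbb C^3\to\mathbb C^6$ is the isometry $|0\rangle,|1\rangle,|2\rangle\mapsto|0\rangle,|1\rangle,|2\rangle$ if that party's outcome is $K_1$, and $|0\rangle,|1\rangle,|2\rangle\mapsto|4\rangle,|5\rangle,|3\rangle$ if it is $K_2$. The resulting set is locally irreducible, both when the three parties are separated and when any two of them come together (that is, with respect to each of the bipartitions $A|BC$, $B|CA$, $C|AB$). So is $\mathcal H$ itself. -/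

import Mathlib

open scoped Matrix

noncomputable section

namespace ActivatedNonlocality

/-! ### Multipartite systems, local measurements, local irreducibility -/

/-- The Hilbert space `(ℂ^α)^{⊗ P}` of the parties `P`, each holding a system with basis `α`:
the coordinate at `x : P → α` is the amplitude of `⊗ᵢ |x i⟩`. -/
abbrev Space (P α : Type) [Fintype P] [DecidableEq P] [Fintype α] : Type :=
  EuclideanSpace ℂ (P → α)

/-- A matrix acting on a vector. -/
def act {β γ : Type} [Fintype β] (A : Matrix γ β ℂ) (v : EuclideanSpace ℂ β) :
    EuclideanSpace ℂ γ :=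
  WithLp.toLp 2 (A *ᵥ v.ofLp)

section General

variable {P α β L : Type} [Fintype P] [DecidableEq P] [Fintype α] [DecidableEq α]

/-- The product vector `⊗ᵢ aᵢ`. -/
def productVec (a : P → EuclideanSpace ℂ α) : Space P α :=
  WithLp.toLp 2 fun x => ∏ i, a i (x i)

def IsProductVec (v : Space P α) : Prop := ∃ a : P → EuclideanSpace ℂ α, v = productVec a

/-- The tensor product `⊗ᵢ Vᵢ` of one operator per party. -/
def tensorOp (V : P → Matrix β α ℂ) : Matrix (P → β) (P → α) ℂ :=
  fun x y => ∏ i, V i (x i) (y i)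

/-- The operator `N ⊗ 1`, where `N` acts jointly on the systems of the parties in `S` and
the identity acts on the systems of all the other parties. -/
def localOp (S : Finset P) (N : Matrix (S → α) (S → α) ℂ) : Matrix (P → α) (P → α) ℂ :=
  fun x y => if ∀ i, i ∉ S → x i = y i then N (fun i => x i) (fun i => y i) else 0

/-- An operator on one copy of `ℂ^α`, seen as an operator of the one-member group `{i}`. -/
def onParty (i : P) (K : Matrix α α ℂ) :
    Matrix (({i} : Finset P) → α) (({i} : Finset P) → α) ℂ :=
  fun x y => K (x ⟨i, Finset.mem_singleton_self i⟩) (y ⟨i, Finset.mem_singleton_self i⟩)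

/-- Measurement operators of a (generalised) measurement: `∑ₖ Mₖ† Mₖ = 1`. -/
def IsMeasurement {κ γ : Type} [Fintype κ] [Fintype γ] [DecidableEq γ]
    (M : κ → Matrix γ γ ℂ) : Prop :=
  ∑ k, (M k)ᴴ * M k = 1

def PairwiseOrthogonal (ψ : L → Space P α) : Prop :=
  Pairwise fun l m => inner ℂ (ψ l) (ψ m) = 0

/-- An orthogonal set of (not necessarily normalised) pure states. -/
def IsOrthogonalSet (ψ : L → Space P α) : Prop :=
  (∀ l, ψ l ≠ 0) ∧ PairwiseOrthogonal ψ

/-- The (unnormalised) post-measurement states, after the group `S` obtained the outcome with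
measurement operator `N`. -/
def postState (S : Finset P) (N : Matrix (S → α) (S → α) ℂ) (ψ : L → Space P α) :
    L → Space P α :=
  fun l => act (localOp S N) (ψ l)

/-- `M` is a local orthogonality preserving measurement of the group `S` on the states `ψ`:
for every outcome, the post-measurement states are again mutually orthogonal. -/
def IsLocalOPM {κ : Type} [Fintype κ] (S : Finset P)
    (M : κ → Matrix (S → α) (S → α) ℂ) (ψ : L → Space P α) : Prop :=
  IsMeasurement M ∧ ∀ k, PairwiseOrthogonal (postState S (M k) ψ)

/-- `Reachable 𝒮 ψ φ`: starting from `ψ`, some branch of a finite-round protocol, in which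
every step is an orthogonality preserving measurement made by one of the groups in `𝒮` (and the
choice of the step may depend on all the earlier outcomes), leads to the unnormalised
states `φ`. -/
inductive Reachable (𝒮 : Set (Finset P)) (ψ : L → Space P α) : (L → Space P α) → Prop
  | start : Reachable 𝒮 ψ ψ
  | step {φ : L → Space P α} {S : Finset P} {m : ℕ} (M : Fin m → Matrix (S → α) (S → α) ℂ)
      (k : Fin m) (hS : S ∈ 𝒮) (hφ : Reachable 𝒮 ψ φ) (hM : IsLocalOPM S M φ) :
      Reachable 𝒮 ψ (postState S (M k) φ)

/-- Some state of the original set is ruled out in the branch `φ`, and the branch does occur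
for some other state of the set. -/
def Eliminates (φ : L → Space P α) : Prop := (∃ l, φ l = 0) ∧ ∃ m, φ m ≠ 0

/-- Local irreducibility, when the members of each group in `𝒮` may measure jointly: `ψ` is an
orthogonal set, and no state can be eliminated from it by orthogonality preserving
local measurements (and classical communication). -/
def LocallyIrreducible (𝒮 : Set (Finset P)) (ψ : L → Space P α) : Prop :=
  IsOrthogonalSet ψ ∧ ∀ φ, Reachable 𝒮 ψ φ → ¬ Eliminates φ

/-- All parties are separated. -/
def separated (P : Type) : Set (Finset P) := Set.range fun i => {i}

/-- All parties but `i` have come together. -/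
def allBut (i : P) : Set (Finset P) := {{i}, {i}ᶜ}

/-- `φ` is the image of `ψ` under the local isometries `Vᵢ`, up to nonzero scalar factors. -/
def IsLocalCopy [Fintype β] [DecidableEq β] (V : P → Matrix β α ℂ) (ψ : L → Space P α)
    (φ : L → Space P β) : Prop :=
  (∀ i, (V i)ᴴ * V i = 1) ∧
    ∃ c : L → ℂ, (∀ l, c l ≠ 0) ∧ ∀ l, φ l = c l • act (tensorOp V) (ψ l)

end General

/-! ### The sets of states -/

/-- The basis vector `|x⟩`. -/
def ket {d : ℕ} (x : Fin d) : EuclideanSpace ℂ (Fin d) := EuclideanSpace.single x 1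

/-- The sign `+1` (`true`) or `-1` (`false`). -/
def sgn (s : Bool) : ℂ := if s then 1 else -1

/-- The single-party states out of which the product states are built. -/
inductive Letter
  | p | q | r
  | eta (s : Bool)
  | kappa (s : Bool)

/-- The labels of the 27 states: `(i, ±)` with `i = 1,…,12`, and three single ones. -/
abbrev Label : Type := (Fin 12 × Bool) ⊕ Fin 3

open Letter in
/-- The single-party states of the parties `0, 1, 2` in each of the 27 product states. -/
def word : Label → Fin 3 → Letter
  | .inl (i, s) =>
    ![![p, q, eta s], ![p, r, kappa s], ![q, r, eta s], ![r, q, kappa s],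
      ![q, eta s, p], ![r, kappa s, p], ![r, eta s, q], ![q, kappa s, r],
      ![eta s, p, q], ![kappa s, p, r], ![eta s, q, r], ![kappa s, r, q]] i
  | .inr j => ![![p, p, p], ![q, q, q], ![r, r, r]] j

/-- `|0-4⟩`, `|1-5⟩`, `|2-3⟩`, `|0±1+4±5⟩` and `|0±2+4±3⟩` in `ℂ⁶` (not normalised). -/
def letterG3 : Letter → EuclideanSpace ℂ (Fin 6)
  | .p => ket 0 - ket 4
  | .q => ket 1 - ket 5
  | .r => ket 2 - ket 3
  | .eta s => ket 0 + sgn s • ket 1 + ket 4 + sgn s • ket 5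
  | .kappa s => ket 0 + sgn s • ket 2 + ket 4 + sgn s • ket 3

/-- `|0⟩`, `|1⟩`, `|2⟩`, `(|0⟩±|1⟩)/√2` and `(|0⟩±|2⟩)/√2` in `ℂ³`. -/
def letterHalder : Letter → EuclideanSpace ℂ (Fin 3)
  | .p => ket 0
  | .q => ket 1
  | .r => ket 2
  | .eta s => ((Real.sqrt 2 : ℝ) : ℂ)⁻¹ • (ket 0 + sgn s • ket 1)
  | .kappa s => ((Real.sqrt 2 : ℝ) : ℂ)⁻¹ • (ket 0 + sgn s • ket 2)

/-- The set `G₃` of 27 product states in `ℂ⁶ ⊗ ℂ⁶ ⊗ ℂ⁶`. -/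
def G3 (l : Label) : Space (Fin 3) (Fin 6) := productVec fun i => letterG3 (word l i)

/-- The set of Halder et al., 27 product states in `ℂ³ ⊗ ℂ³ ⊗ ℂ³`. -/
def halder (l : Label) : Space (Fin 3) (Fin 3) := productVec fun i => letterHalder (word l i)

/-! ### The local measurements -/

/-- The projectors of `ℂ⁶` onto `span{|0⟩,|1⟩,|2⟩}` and onto `span{|3⟩,|4⟩,|5⟩}`. -/
def proj : Fin 2 → Matrix (Fin 6) (Fin 6) ℂ :=
  ![Matrix.diagonal ![1, 1, 1, 0, 0, 0], Matrix.diagonal ![0, 0, 0, 1, 1, 1]]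

/-- The values `(p, q, r)` for each outcome: `(0, 1, 2)` and `(4, 5, 3)`. -/
def pqr : Fin 2 → Fin 3 → Fin 6 := ![![0, 1, 2], ![4, 5, 3]]

/-- The linear map `ℂ³ → ℂ⁶` with `|0⟩, |1⟩, |2⟩ ↦ |p⟩, |q⟩, |r⟩`. -/
def embed (k : Fin 2) : Matrix (Fin 6) (Fin 3) ℂ := fun x y => if x = pqr k y then 1 else 0

/-- The states of `G₃` after the parties in the list have measured `proj`, the last party of the
list first, party `i` having obtained the outcome `o i`. -/
def measured (o : Fin 3 → Fin 2) : List (Fin 3) → Label → Space (Fin 3) (Fin 6)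
  | [] => G3
  | i :: t => postState {i} (onParty i (proj (o i))) (measured o t)

end ActivatedNonlocality

end

/-!
The mechanism is that `ℂ⁶` holds two copies of `ℂ³`, spanned by `|0⟩, |1⟩, |2⟩` and by
`|4⟩, |5⟩, |3⟩`. The projection of each letter of `G₃` to either copy is, up to a sign or a factor
`√2`, the corresponding letter of the model set `ℋ` (`act_proj_letterG3`). Orthogonality of two
letters can therefore be read off one table `orth` for all the states involved, whether or not a
party has measured; any two of the 27 words contain a pair of orthogonal letters in the same position
(`exists_orth_of_ne`), so every intermediate set is orthogonal.

Local irreducibility rests on a rigidity statement in `ℂ³ ⊗ ℂ³ ⊗ ℂ³`: an operator `E` of one party,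
or of two parties jointly, for which `⟨h_l, (E ⊗ 1) h_m⟩ = 0` for all `l ≠ m` is a multiple of the
identity (`eq_scalar_of_orthogonal_left`, `eq_scalar_of_orthogonal_right`). Two words whose letters
for the remaining parties overlap give a vanishing matrix element of `E`; with the two signs of `η`
and `κ` these elements kill all the off-diagonal entries, and the elements between the opposite signs
of one family then equate the diagonal entries. Since the words are invariant under cyclic shifts of
the parties, it is enough to look at party `0` and its complement.

Fix a party `i`, and suppose that all measurements are made inside `{i}` or inside `{i}ᶜ`, which
covers the separated parties and the bipartition. Then in every branch the states are
`(A ⊗ B) h_l` up to nonzero scalars, with `A` and `B` multiples of isometries, or else all of them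
vanish (`IsBlockCopy.eq_zero_or_postState`): rigidity, applied to `Aᴴ * A` or `Bᴴ * B` after the
measurement, carries this from one step to the next. So no state can be eliminated alone. The initial
states may be any image of `ℋ` under local isometries, in particular `ℋ` itself and the eight sets
left over from `G₃`.
-/

open scoped Kronecker

namespace ActivatedNonlocality

/-! ### The words and their orthogonality -/

/-- Decides orthogonality of two single-party states, by their names. The same table serves the
letters of both sets of states. -/
def orth : Letter → Letter → Bool
  | .p, .q | .p, .r | .q, .p | .q, .r | .r, .p | .r, .q => true
  | .q, .kappa _ | .kappa _, .q | .r, .eta _ | .eta _, .r => true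
  | .eta s, .eta t | .kappa s, .kappa t => s != t
  | _, _ => false

/-- Any two of the 27 words are told apart by some single party: at one position their letters
are orthogonal. -/
theorem exists_orth_of_ne : ∀ l m : Label, l ≠ m → ∃ i, orth (word l i) (word m i) = true := by
  decide +kernel

/-- `rot i l` is the label of the word `l` shifted cyclically by `i` positions (`word_rot`). The
twelve families form three blocks of four, and the shift permutes the blocks; it fixes the three
constant words. -/
def rot (i : Fin 3) : Label → Label
  | .inl (k, s) => .inl (k + ![0, 8, 4] i, s)
  | .inr j => .inr j

theorem rot_injective (i : Fin 3) : Function.Injective (rot i) := by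
  rintro (⟨k, s⟩ | j) (⟨k', s'⟩ | j') h <;> simp_all [rot]

theorem word_rot (i : Fin 3) (l : Label) (j : Fin 3) : word (rot i l) (i + j) = word l j := by
  rcases l with ⟨k, s⟩ | k
  · fin_cases i <;> fin_cases k <;> fin_cases j <;> rfl
  · fin_cases i <;> fin_cases k <;> fin_cases j <;> rfl

/-- The sum of `f` against the letter `a` of `ℂ³`, without the factor `1/√2` of `η` and `κ`. The
amplitudes are real, so the same sum serves bras and kets. -/
noncomputable def pair : Letter → (Fin 3 → ℂ) → ℂ
  | .p, f => f 0
  | .q, f => f 1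
  | .r, f => f 2
  | .eta s, f => f 0 + sgn s * f 1
  | .kappa s, f => f 0 + sgn s * f 2

/-- The matrix element `⟨a|E|b⟩` between unnormalised letters of `ℂ³`; for `E = 1` the overlap. -/
noncomputable def pair₁ (E : Matrix (Fin 3) (Fin 3) ℂ) (a b : Letter) : ℂ :=
  pair a fun x => pair b fun y => E x y

/-- The matrix element `⟨a ⊗ b|F|c ⊗ d⟩` between products of unnormalised letters of `ℂ³`. -/
noncomputable def pair₂ (F : Matrix (Fin 3 × Fin 3) (Fin 3 × Fin 3) ℂ) (a b c d : Letter) : ℂ :=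
  pair a fun x => pair b fun y => pair c fun z => pair d fun w => F (x, y) (z, w)

theorem pair₁_one_eq_zero {a b : Letter} (h : orth a b = true) : pair₁ 1 a b = 0 := by
  rcases a with _ | _ | _ | s | s <;> rcases b with _ | _ | _ | t | t <;>
    simp [orth, pair₁, pair] at h ⊢ <;> cases s <;> cases t <;> simp [sgn] at h ⊢

theorem pair₁_one_ne_zero {a b : Letter} (h : orth a b = false) : pair₁ 1 a b ≠ 0 := by
  rcases a with _ | _ | _ | s | s <;> rcases b with _ | _ | _ | t | t <;>
    simp [orth, pair₁, pair] at h ⊢ <;>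
    first
    | (cases s; all_goals (cases t; all_goals (simp [sgn] at h ⊢; try norm_num)))
    | (cases s; all_goals simp [sgn])
    | (cases t; all_goals simp [sgn])

/-! ### Rigidity of the words -/

/-- A single party cannot disturb the states without losing orthogonality. If two words overlap in
the other two positions, the matrix element of `E` between their letters in position `0` vanishes. -/
theorem eq_scalar_of_pair₁ {E : Matrix (Fin 3) (Fin 3) ℂ}
    (H : ∀ l m, l ≠ m → pair₁ E (word l 0) (word m 0) *
      (pair₁ 1 (word l 1) (word m 1) * pair₁ 1 (word l 2) (word m 2)) = 0) :
    E = E 0 0 • 1 := by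
  have K : ∀ l m, l ≠ m → orth (word l 1) (word m 1) = false → orth (word l 2) (word m 2) = false →
      pair₁ E (word l 0) (word m 0) = 0 := fun l m h h₁ h₂ =>
    (mul_eq_zero.1 (H l m h)).resolve_right
      (mul_ne_zero (pair₁_one_ne_zero h₁) (pair₁_one_ne_zero h₂))
  have h01 : E 0 1 = 0 := K (.inl (0, true)) (.inr 1) (by decide) rfl rfl
  have h10 : E 1 0 = 0 := K (.inr 1) (.inl (0, true)) (by decide) rfl rfl
  have h02 : E 0 2 = 0 := K (.inl (1, true)) (.inr 2) (by decide) rfl rfl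
  have h20 : E 2 0 = 0 := K (.inr 2) (.inl (1, true)) (by decide) rfl rfl
  have h12 : E 1 2 = 0 := K (.inl (4, true)) (.inl (5, true)) (by decide) rfl rfl
  have h21 : E 2 1 = 0 := K (.inl (5, true)) (.inl (4, true)) (by decide) rfl rfl
  -- `⟨0 + 1|E|0 - 1⟩ = 0` and `⟨0 + 2|E|0 - 2⟩ = 0` compare the diagonal entries.
  have h11 := K (.inl (8, true)) (.inl (8, false)) (by decide) rfl rfl
  have h22 := K (.inl (9, true)) (.inl (9, false)) (by decide) rfl rfl
  simp [word, pair₁, pair, sgn, h01, h10, h02, h20] at h11 h22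
  have h11' : E 1 1 = E 0 0 := by linear_combination -h11
  have h22' : E 2 2 = E 0 0 := by linear_combination -h22
  ext a b
  fin_cases a <;> fin_cases b <;> simp [h01, h10, h02, h20, h12, h21, h11', h22']

theorem eq_zero_of_forall_sgn {x y : ℂ} (h : ∀ s, x + sgn s * y = 0) : x = 0 ∧ y = 0 := by
  have h₁ := h true
  have h₂ := h false
  simp only [sgn, if_true, Bool.false_eq_true, if_false] at h₁ h₂
  exact ⟨by linear_combination (h₁ + h₂) / 2, by linear_combination (h₁ - h₂) / 2⟩

/-- The off-diagonal entries of an operator `F` of two parties that keeps the states orthogonal,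
one of each pair of transposed entries. The words starting with `η` or `κ` end in the kets `01`,
`02`, `12`, `21`, and they overlap in position `0` with each other and with the words starting with
`p`, whose last two letters span `00`, `10`, `11`, `20`, `22`. So `F` has no entries between these
groups or between `01`, `02`, `12`, `21`; the rest follows from words starting with `p`, `q`, `r`. -/
theorem pair₂_off_diagonal {F : Matrix (Fin 3 × Fin 3) (Fin 3 × Fin 3) ℂ}
    (K : ∀ l m, l ≠ m → orth (word l 0) (word m 0) = false →
      pair₂ F (word l 1) (word l 2) (word m 1) (word m 2) = 0) :
    (F (0, 1) (0, 2) = 0 ∧ F (0, 1) (1, 2) = 0 ∧ F (0, 1) (2, 1) = 0 ∧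
      F (0, 2) (1, 2) = 0 ∧ F (0, 2) (2, 1) = 0 ∧ F (1, 2) (2, 1) = 0) ∧
    (∀ y ∈ ([(0, 1), (0, 2), (1, 2), (2, 1)] : List (Fin 3 × Fin 3)),
      F (0, 0) y = 0 ∧ (F (1, 0) y = 0 ∧ F (1, 1) y = 0) ∧ F (2, 0) y = 0 ∧ F (2, 2) y = 0) ∧
    ((F (1, 0) (0, 0) = 0 ∧ F (1, 1) (0, 0) = 0) ∧ F (2, 0) (0, 0) = 0 ∧ F (2, 2) (0, 0) = 0) ∧
    ((F (1, 0) (2, 0) = 0 ∧ F (1, 1) (2, 0) = 0) ∧ F (1, 0) (2, 2) = 0 ∧ F (1, 1) (2, 2) = 0) ∧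
    F (1, 0) (1, 1) = 0 ∧ F (2, 0) (2, 2) = 0 := by
  -- The families `k ≥ 8` end in a ket `y`; each is compared with all the words starting with `p`.
  have basis : ∀ k : Fin 12, 8 ≤ k → ∀ y : Fin 3 × Fin 3,
      (∀ a b, pair₂ F a b (word (.inl (k, true)) 1) (word (.inl (k, true)) 2) =
        pair a fun x => pair b fun z => F (x, z) y) →
      (∀ a : Letter, a = .p → orth a (word (.inl (k, true)) 0) = false) →
      F (0, 0) y = 0 ∧ (F (1, 0) y = 0 ∧ F (1, 1) y = 0) ∧ F (2, 0) y = 0 ∧ F (2, 2) y = 0 := by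
    intro k hk y hy ho
    refine ⟨?_, eq_zero_of_forall_sgn fun s => ?_, eq_zero_of_forall_sgn fun s => ?_⟩
    · exact (hy .p .p).symm.trans (K (.inr 0) _ (by simp) (ho _ rfl))
    · exact (hy .q (.eta s)).symm.trans (K (.inl (0, s)) _
        (by simp; rintro rfl; exact absurd hk (by decide)) (ho _ rfl))
    · exact (hy .r (.kappa s)).symm.trans (K (.inl (1, s)) _
        (by simp; rintro rfl; exact absurd hk (by decide)) (ho _ rfl))
  refine ⟨⟨?_, ?_, ?_, ?_, ?_, ?_⟩, ?_, ⟨?_, ?_⟩, ?_, ?_, ?_⟩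
  · exact K (.inl (8, true)) (.inl (9, true)) (by decide) rfl
  · exact K (.inl (8, true)) (.inl (10, true)) (by decide) rfl
  · exact K (.inl (8, true)) (.inl (11, true)) (by decide) rfl
  · exact K (.inl (9, true)) (.inl (10, true)) (by decide) rfl
  · exact K (.inl (9, true)) (.inl (11, true)) (by decide) rfl
  · exact K (.inl (10, true)) (.inl (11, true)) (by decide) rfl
  · simp only [List.forall_mem_cons, List.not_mem_nil, false_imp_iff, implies_true, and_true]
    refine ⟨basis 8 (by decide) _ (fun _ _ => rfl) ?_, basis 9 (by decide) _ (fun _ _ => rfl) ?_,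
      basis 10 (by decide) _ (fun _ _ => rfl) ?_, basis 11 (by decide) _ (fun _ _ => rfl) ?_⟩ <;>
    · rintro _ rfl
      rfl
  · exact eq_zero_of_forall_sgn fun s => K (.inl (0, s)) (.inr 0) (by simp) rfl
  · exact eq_zero_of_forall_sgn fun s => K (.inl (1, s)) (.inr 0) (by simp) rfl
  · have h : ∀ t, _ := fun t => eq_zero_of_forall_sgn fun s =>
      K (.inl (0, s)) (.inl (1, t)) (by simp) rfl
    have h₁ := eq_zero_of_forall_sgn fun t => (h t).1
    have h₂ := eq_zero_of_forall_sgn fun t => (h t).2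
    exact ⟨⟨h₁.1, h₂.1⟩, h₁.2, h₂.2⟩
  · exact (eq_zero_of_forall_sgn fun s => K (.inl (4, s)) (.inr 1) (by simp) rfl).2
  · exact (eq_zero_of_forall_sgn fun s => K (.inl (5, s)) (.inr 2) (by simp) rfl).2

theorem pair_comm (a b : Letter) (f : Fin 3 → Fin 3 → ℂ) :
    (pair a fun x => pair b fun y => f x y) = pair b fun y => pair a fun x => f x y := by
  rcases a with _ | _ | _ | s | s <;> rcases b with _ | _ | _ | t | t <;> simp only [pair] <;> ring

theorem pair₂_transpose (F : Matrix (Fin 3 × Fin 3) (Fin 3 × Fin 3) ℂ) (a b c d : Letter) :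
    pair₂ Fᵀ a b c d = pair₂ F c d a b := by
  simp only [pair₂, Matrix.transpose_apply]
  simp_rw [pair_comm b c, pair_comm a c, pair_comm b d, pair_comm a d]

theorem orth_comm (a b : Letter) : orth a b = orth b a := by
  rcases a with _ | _ | _ | s | s <;> rcases b with _ | _ | _ | t | t <;>
    simp [orth, bne_comm]

/-- Two parties together cannot disturb the states without losing orthogonality. -/
theorem eq_scalar_of_pair₂ {F : Matrix (Fin 3 × Fin 3) (Fin 3 × Fin 3) ℂ}
    (H : ∀ l m, l ≠ m → pair₁ 1 (word l 0) (word m 0) *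
      pair₂ F (word l 1) (word l 2) (word m 1) (word m 2) = 0) :
    F = F (0, 0) (0, 0) • 1 := by
  have K : ∀ l m, l ≠ m → orth (word l 0) (word m 0) = false →
      pair₂ F (word l 1) (word l 2) (word m 1) (word m 2) = 0 := fun l m h h₁ =>
    (mul_eq_zero.1 (H l m h)).resolve_left (pair₁_one_ne_zero h₁)
  have h := pair₂_off_diagonal K
  -- The hypothesis is symmetric under transposition, which gives the other half of the entries.
  have h' := pair₂_off_diagonal (F := Fᵀ) fun l m hne ho => by
    rw [pair₂_transpose]
    exact K m l hne.symm (by rwa [orth_comm])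
  simp only [List.forall_mem_cons, List.not_mem_nil, false_imp_iff, implies_true, and_true,
    Matrix.transpose_apply] at h h'
  have off : ∀ x y, x ≠ y → F x y = 0 := by
    rintro ⟨x₁, x₂⟩ ⟨y₁, y₂⟩ hne
    fin_cases x₁ <;> fin_cases x₂ <;> fin_cases y₁ <;> fin_cases y₂ <;>
      first | exact absurd rfl hne | simp [h, h']
  -- The two signs of one family give `⟨x + y|F|x - y⟩ = 0`, which compares `F x x` with `F y y`.
  have diag : ∀ k x y, x ≠ y → pair₂ F (word (.inl (k, true)) 1) (word (.inl (k, true)) 2)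
      (word (.inl (k, false)) 1) (word (.inl (k, false)) 2) =
        F x x + sgn false * F x y + sgn true * (F y x + sgn false * F y y) →
      orth (word (.inl (k, true)) 0) (word (.inl (k, false)) 0) = false → F y y = F x x := by
    intro k x y hne hk ho
    have := hk.symm.trans (K (.inl (k, true)) (.inl (k, false)) (by simp) ho)
    simp only [off x y hne, off y x hne.symm, sgn, if_true, Bool.false_eq_true, if_false] at this
    linear_combination -this
  have d₁ : F (1, 0) (1, 0) = F (0, 0) (0, 0) := diag 4 _ _ (by decide) rfl rfl
  have d₂ : F (2, 0) (2, 0) = F (0, 0) (0, 0) := diag 5 _ _ (by decide) rfl rfl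
  have d₃ : F (1, 1) (1, 1) = F (0, 0) (0, 0) := (diag 0 _ _ (by decide) rfl rfl).trans d₁
  have d₄ : F (2, 2) (2, 2) = F (0, 0) (0, 0) := (diag 1 _ _ (by decide) rfl rfl).trans d₂
  have d₅ : F (2, 1) (2, 1) = F (0, 0) (0, 0) := (diag 2 _ _ (by decide) rfl rfl).trans d₂
  have d₆ : F (1, 2) (1, 2) = F (0, 0) (0, 0) := (diag 3 _ _ (by decide) rfl rfl).trans d₁
  have d₇ : F (0, 1) (0, 1) = F (0, 0) (0, 0) := (diag 6 _ _ (by decide) rfl rfl).symm.trans d₃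
  have d₈ : F (0, 2) (0, 2) = F (0, 0) (0, 0) := (diag 7 _ _ (by decide) rfl rfl).symm.trans d₄
  ext x y
  by_cases hxy : x = y
  · subst hxy
    obtain ⟨x₁, x₂⟩ := x
    fin_cases x₁ <;> fin_cases x₂ <;> simp [d₁, d₂, d₃, d₄, d₅, d₆, d₇, d₈]
  · simp [off x y hxy, hxy]

/-! ### Operators on one party and on the other two -/

section Blocks

variable {α β γ : Type}

/-- Coordinates of three parties, seen from party `i`: its own, and those of the parties `i + 1`
and `i + 2`. -/
def splitAt (i : Fin 3) : (Fin 3 → α) ≃ α × α × α where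
  toFun x := (x i, x (i + 1), x (i + 2))
  invFun y := fun j => ![y.1, y.2.1, y.2.2] (j - i)
  left_inv x := by
    funext j
    fin_cases i <;> fin_cases j <;> rfl
  right_inv y := by
    fin_cases i <;> rfl

/-- The operator `A ⊗ B`, with `A` on party `i` and `B` jointly on the parties `i + 1` and `i + 2`. -/
def blockOp (i : Fin 3) (A : Matrix β α ℂ) (B : Matrix (β × β) (α × α) ℂ) :
    Matrix (Fin 3 → β) (Fin 3 → α) ℂ :=
  (A ⊗ₖ B).submatrix (splitAt i) (splitAt i)

theorem prod_univ_cyclic {M : Type*} [CommMonoid M] (i : Fin 3) (f : Fin 3 → M) :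
    ∏ j, f j = f i * (f (i + 1) * f (i + 2)) := by
  rw [Fin.prod_univ_three]
  fin_cases i
  · exact mul_assoc _ _ _
  · exact (mul_assoc _ _ _).trans (mul_comm _ _) |>.trans (mul_assoc _ _ _)
  · exact mul_comm _ _

theorem act_act [Fintype α] [Fintype β] (A : Matrix γ β ℂ) (B : Matrix β α ℂ)
    (v : EuclideanSpace ℂ α) : act A (act B v) = act (A * B) v := by
  simp [act]

theorem act_smul [Fintype α] (A : Matrix β α ℂ) (c : ℂ) (v : EuclideanSpace ℂ α) :
    act A (c • v) = c • act A v := by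
  simp [act, Matrix.mulVec_smul]

theorem act_zero [Fintype α] (A : Matrix β α ℂ) : act A (0 : EuclideanSpace ℂ α) = 0 := by
  simp [act]

theorem smul_act [Fintype α] (A : Matrix β α ℂ) (c : ℂ) (v : EuclideanSpace ℂ α) :
    act (c • A) v = c • act A v := by
  simp [act, Matrix.smul_mulVec]

theorem add_act [Fintype α] (A B : Matrix β α ℂ) (v : EuclideanSpace ℂ α) :
    act (A + B) v = act A v + act B v := by
  simp [act, Matrix.add_mulVec]

theorem act_one [Fintype α] [DecidableEq α] (v : EuclideanSpace ℂ α) : act 1 v = v := by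
  simp [act]

theorem inner_act_act [Fintype α] [Fintype β] (X Y : Matrix β α ℂ) (v w : EuclideanSpace ℂ α) :
    inner ℂ (act X v) (act Y w) = inner ℂ v (act (Xᴴ * Y) w) := by
  simp only [act, EuclideanSpace.inner_eq_star_dotProduct]
  rw [dotProduct_comm, dotProduct_comm _ (star v.ofLp), Matrix.star_mulVec,
    ← Matrix.dotProduct_mulVec, Matrix.mulVec_mulVec]

theorem blockOp_mul [Fintype β] (i : Fin 3) (A : Matrix γ β ℂ) (B : Matrix (γ × γ) (β × β) ℂ)
    (A' : Matrix β α ℂ) (B' : Matrix (β × β) (α × α) ℂ) :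
    blockOp i A B * blockOp i A' B' = blockOp i (A * A') (B * B') := by
  simp only [blockOp, Matrix.submatrix_mul_equiv, ← Matrix.mul_kronecker_mul]

theorem blockOp_conjTranspose (i : Fin 3) (A : Matrix β α ℂ) (B : Matrix (β × β) (α × α) ℂ) :
    (blockOp i A B)ᴴ = blockOp i Aᴴ Bᴴ := by
  simp only [blockOp, Matrix.conjTranspose_submatrix, Matrix.conjTranspose_kronecker]

theorem blockOp_smul_smul (i : Fin 3) (a b : ℂ) (A : Matrix β α ℂ)
    (B : Matrix (β × β) (α × α) ℂ) :
    blockOp i (a • A) (b • B) = (a * b) • blockOp i A B := by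
  ext x y
  simp [blockOp, Matrix.kroneckerMap_apply]
  ring

theorem blockOp_one [DecidableEq α] (i : Fin 3) : blockOp i (1 : Matrix α α ℂ) 1 = 1 := by
  simp [blockOp]

theorem tensorOp_eq_blockOp (i : Fin 3) (V : Fin 3 → Matrix β α ℂ) :
    tensorOp V = blockOp i (V i) (V (i + 1) ⊗ₖ V (i + 2)) := by
  ext x y
  simp [tensorOp, blockOp, splitAt, prod_univ_cyclic i]

theorem localOp_singleton [DecidableEq α] (i : Fin 3)
    (N : Matrix (({i} : Finset (Fin 3)) → α) (({i} : Finset (Fin 3)) → α) ℂ) :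
    localOp {i} N = blockOp i (.of fun x y => N (fun _ => x) (fun _ => y)) 1 := by
  ext x y
  have hN : N (fun j => x j) (fun j => y j) = N (fun _ => x i) (fun _ => y i) := by
    have hz : ∀ z : Fin 3 → α, (fun j : ({i} : Finset (Fin 3)) => z j) = fun _ => z i :=
      fun z => funext fun j => congrArg z (Finset.mem_singleton.1 j.2)
    rw [hz, hz]
  have h : (∀ j, j ∉ ({i} : Finset (Fin 3)) → x j = y j) ↔
      x (i + 1) = y (i + 1) ∧ x (i + 2) = y (i + 2) := by
    simp only [Finset.mem_singleton]
    fin_cases i <;> simp [Fin.forall_fin_succ]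
    tauto
  simp only [localOp, h, hN]
  simp [blockOp, splitAt, Matrix.one_apply]

/-- What any group without party `i` does, it does jointly with all parties but `i`. -/
theorem exists_localOp_eq_blockOp [DecidableEq α] [Nonempty α] {i : Fin 3} {S : Finset (Fin 3)}
    (hi : i ∉ S) (N : Matrix (S → α) (S → α) ℂ) : ∃ B, localOp S N = blockOp i 1 B := by
  obtain ⟨a⟩ := ‹Nonempty α›
  -- The coordinate of party `i` is fixed to the arbitrary value `a`, on which `localOp S N` does not
  -- depend.
  refine ⟨.of fun x y => localOp S N ((splitAt i).symm (a, x)) ((splitAt i).symm (a, y)), ?_⟩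
  ext x y
  have hs : ∀ (z : Fin 3 → α) j, j ≠ i → (splitAt i).symm (a, z (i + 1), z (i + 2)) j = z j := by
    intro z j hj
    fin_cases i <;> fin_cases j <;> first | rfl | exact absurd rfl hj
  have hi' : ∀ z : α × α, (splitAt i).symm (a, z) i = a := by
    intro z
    simp [splitAt]
  have hN : ∀ z : Fin 3 → α, (fun j : S => (splitAt i).symm (a, z (i + 1), z (i + 2)) j) =
      fun j : S => z j := fun z => funext fun j => hs z j fun h => hi (h ▸ j.2)
  have h : (∀ j, j ∉ S → x j = y j) ↔ x i = y i ∧ ∀ j, j ∉ S →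
      (splitAt i).symm (a, x (i + 1), x (i + 2)) j =
        (splitAt i).symm (a, y (i + 1), y (i + 2)) j := by
    refine ⟨fun h => ⟨h i hi, fun j hj => ?_⟩, fun h j hj => ?_⟩
    · by_cases hji : j = i
      · rw [hji, hi', hi']
      · rw [hs x j hji, hs y j hji, h j hj]
    · by_cases hji : j = i
      · rw [hji, h.1]
      · rw [← hs x j hji, ← hs y j hji, h.2 j hj]
  simp only [localOp, blockOp, Matrix.submatrix_apply, Matrix.kroneckerMap_apply, Matrix.of_apply,
    Matrix.one_apply]
  have hx : ∀ z : Fin 3 → α, splitAt i z = (z i, z (i + 1), z (i + 2)) := fun _ => rfl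
  simp only [hx, hN, h, ite_and, ite_mul, one_mul, zero_mul]

theorem sum_mul_prod [Fintype α] [Fintype β] (f : α → ℂ) (g : β → ℂ) :
    ∑ z : α × β, f z.1 * g z.2 = (∑ x, f x) * ∑ y, g y := by
  rw [Fintype.sum_prod_type, Finset.sum_mul_sum]

theorem inner_productVec_blockOp [Fintype α] (i : Fin 3) (a b : Fin 3 → EuclideanSpace ℂ α)
    (E : Matrix α α ℂ) (F : Matrix (α × α) (α × α) ℂ) :
    inner ℂ (productVec a) (act (blockOp i E F) (productVec b)) =
      (∑ x, star (a i x) * ∑ y, b i y * E x y) *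
        ∑ x, star (a (i + 1) x) * ∑ y, star (a (i + 2) y) * ∑ z, b (i + 1) z * ∑ w, b (i + 2) w *
          F (x, y) (z, w) := by
  have key : ∀ x : Fin 3 → α, (blockOp i E F *ᵥ fun y => ∏ j, b j (y j)) x =
      (∑ y, b i y * E (x i) y) *
        ∑ z : α × α, b (i + 1) z.1 * b (i + 2) z.2 * F (x (i + 1), x (i + 2)) z := by
    intro x
    rw [← sum_mul_prod, Matrix.mulVec, dotProduct, ← (splitAt i).sum_comp]
    refine Finset.sum_congr rfl fun y _ => ?_
    rw [prod_univ_cyclic i]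
    simp only [blockOp, splitAt, Matrix.submatrix_apply, Matrix.kroneckerMap_apply,
      Equiv.coe_fn_mk]
    ring
  have hF : ∑ x, star (a (i + 1) x) * ∑ y, star (a (i + 2) y) * ∑ z, b (i + 1) z *
      ∑ w, b (i + 2) w * F (x, y) (z, w) = ∑ x : α × α, star (a (i + 1) x.1) *
        star (a (i + 2) x.2) * ∑ z : α × α, b (i + 1) z.1 * b (i + 2) z.2 * F x z := by
    simp only [Fintype.sum_prod_type, Finset.mul_sum, mul_assoc]
  rw [hF, ← sum_mul_prod, EuclideanSpace.inner_eq_star_dotProduct, dotProduct,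
    ← (splitAt i).sum_comp]
  refine Finset.sum_congr rfl fun x _ => ?_
  simp only [act, productVec, key, Pi.star_apply, splitAt, Equiv.coe_fn_mk]
  rw [prod_univ_cyclic i]
  simp only [star_mul']
  ring

theorem inner_productVec [Fintype α] {P : Type} [Fintype P] [DecidableEq P]
    (a b : P → EuclideanSpace ℂ α) :
    inner ℂ (productVec a) (productVec b) = ∏ i, inner ℂ (a i) (b i) := by
  simp only [productVec, EuclideanSpace.inner_eq_star_dotProduct, dotProduct]
  rw [Finset.prod_univ_sum, Fintype.piFinset_univ]
  simp [Finset.prod_mul_distrib]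

theorem act_tensorOp_productVec [Fintype α] [Fintype β] {P : Type} [Fintype P] [DecidableEq P]
    (V : P → Matrix β α ℂ) (a : P → EuclideanSpace ℂ α) :
    act (tensorOp V) (productVec a) = productVec fun i => act (V i) (a i) := by
  ext x
  simp only [act, productVec, tensorOp, Matrix.mulVec, dotProduct]
  rw [Finset.prod_univ_sum, Fintype.piFinset_univ]
  simp [Finset.prod_mul_distrib]

theorem productVec_smul [Fintype α] {P : Type} [Fintype P] [DecidableEq P] (c : P → ℂ)
    (a : P → EuclideanSpace ℂ α) :
    productVec (fun i => c i • a i) = (∏ i, c i) • productVec a := by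
  ext x
  simp [productVec, Finset.prod_mul_distrib]

end Blocks

/-! ### Rigidity of the model set -/

/-- The normalisation that `pair` leaves out: `1/√2` for `η` and `κ`, and `1` otherwise. -/
noncomputable def halderFactor : Letter → ℂ
  | .eta _ | .kappa _ => ((Real.sqrt 2 : ℝ) : ℂ)⁻¹
  | _ => 1

theorem halderFactor_ne_zero (a : Letter) : halderFactor a ≠ 0 := by
  cases a <;> simp [halderFactor]

theorem sum_letterHalder_mul (a : Letter) (f : Fin 3 → ℂ) :
    ∑ x, letterHalder a x * f x = halderFactor a * pair a f := by
  rcases a with _ | _ | _ | s | s <;>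
    simp [letterHalder, halderFactor, pair, ket, Fin.sum_univ_three] <;> ring

theorem star_letterHalder (a : Letter) (x : Fin 3) : star (letterHalder a x) = letterHalder a x := by
  rcases a with _ | _ | _ | s | s <;> fin_cases x <;> simp [letterHalder, ket] <;>
    cases s <;> simp [sgn]

theorem pair_const_mul (a : Letter) (c : ℂ) (f : Fin 3 → ℂ) :
    (pair a fun x => c * f x) = c * pair a f := by
  cases a <;> simp only [pair] <;> ring

theorem inner_halder_blockOp (i : Fin 3) (E : Matrix (Fin 3) (Fin 3) ℂ)
    (F : Matrix (Fin 3 × Fin 3) (Fin 3 × Fin 3) ℂ) (l m : Label) :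
    ∃ c : ℂ, c ≠ 0 ∧ inner ℂ (halder l) (act (blockOp i E F) (halder m)) =
      c * (pair₁ E (word l i) (word m i) *
        pair₂ F (word l (i + 1)) (word l (i + 2)) (word m (i + 1)) (word m (i + 2))) := by
  refine ⟨halderFactor (word l i) * halderFactor (word m i) *
    (halderFactor (word l (i + 1)) * halderFactor (word l (i + 2)) *
      halderFactor (word m (i + 1)) * halderFactor (word m (i + 2))), ?_, ?_⟩
  · simp [halderFactor_ne_zero]
  · simp only [halder, inner_productVec_blockOp, star_letterHalder, sum_letterHalder_mul,
      pair_const_mul, pair₁, pair₂]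
    ring

theorem pair₂_one (a b c d : Letter) : pair₂ 1 a b c d = pair₁ 1 a c * pair₁ 1 b d := by
  have h : ∀ x y z w : Fin 3, (1 : Matrix (Fin 3 × Fin 3) (Fin 3 × Fin 3) ℂ) (x, y) (z, w) =
      (1 : Matrix (Fin 3) (Fin 3) ℂ) x z * (1 : Matrix (Fin 3) (Fin 3) ℂ) y w := by
    intro x y z w
    simp only [Matrix.one_apply, Prod.mk.injEq, ite_and, ite_mul, one_mul, zero_mul]
  have hr : ∀ (a : Letter) (f : Fin 3 → ℂ) (k : ℂ), (pair a fun x => f x * k) = pair a f * k := by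
    intro a f k
    simp only [mul_comm _ k, pair_const_mul]
  simp only [pair₂, pair₁, h, pair_const_mul, hr]

/-- By the cyclic symmetry of the words, orthogonality conditions seen from party `i` become those
seen from party `0`. -/
theorem pair₁_mul_pair₂_eq_zero (i : Fin 3) {E : Matrix (Fin 3) (Fin 3) ℂ}
    {F : Matrix (Fin 3 × Fin 3) (Fin 3 × Fin 3) ℂ}
    (H : ∀ l m, l ≠ m → inner ℂ (halder l) (act (blockOp i E F) (halder m)) = 0)
    {l m : Label} (hlm : l ≠ m) : pair₁ E (word l 0) (word m 0) *
      pair₂ F (word l 1) (word l 2) (word m 1) (word m 2) = 0 := by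
  obtain ⟨c, hc, h⟩ := inner_halder_blockOp i E F (rot i l) (rot i m)
  rw [H _ _ ((rot_injective i).ne hlm)] at h
  have h' := (mul_eq_zero.1 h.symm).resolve_left hc
  have h0 : ∀ l, word (rot i l) i = word l 0 := fun l => by simpa using word_rot i l 0
  simpa only [word_rot, h0] using h'

theorem eq_scalar_of_orthogonal_left (i : Fin 3) {E : Matrix (Fin 3) (Fin 3) ℂ}
    (H : ∀ l m, l ≠ m → inner ℂ (halder l) (act (blockOp i E 1) (halder m)) = 0) :
    E = E 0 0 • 1 :=
  eq_scalar_of_pair₁ fun _ _ hlm => pair₂_one _ _ _ _ ▸ pair₁_mul_pair₂_eq_zero i H hlm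

theorem eq_scalar_of_orthogonal_right (i : Fin 3)
    {F : Matrix (Fin 3 × Fin 3) (Fin 3 × Fin 3) ℂ}
    (H : ∀ l m, l ≠ m → inner ℂ (halder l) (act (blockOp i 1 F) (halder m)) = 0) :
    F = F (0, 0) (0, 0) • 1 :=
  eq_scalar_of_pair₂ fun _ _ hlm => pair₁_mul_pair₂_eq_zero i H hlm

/-! ### Orthogonality of the model set -/

theorem inner_letterHalder (a b : Letter) : inner ℂ (letterHalder a) (letterHalder b) =
    halderFactor a * halderFactor b * pair₁ 1 a b := by
  have : inner ℂ (letterHalder a) (letterHalder b) =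
      ∑ x, letterHalder a x * ∑ y, letterHalder b y * (1 : Matrix (Fin 3) (Fin 3) ℂ) x y := by
    simp only [EuclideanSpace.inner_eq_star_dotProduct, dotProduct, Pi.star_apply,
      star_letterHalder, Matrix.one_apply, mul_ite, mul_one, mul_zero, Finset.sum_ite_eq,
      Finset.mem_univ, if_true]
    exact Finset.sum_congr rfl fun _ _ => mul_comm _ _
  rw [this]
  simp only [sum_letterHalder_mul, pair_const_mul, pair₁]
  ring

theorem pairwiseOrthogonal_productVec {α : Type} [Fintype α] [DecidableEq α]
    {u : Fin 3 → Letter → EuclideanSpace ℂ α}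
    (hu : ∀ i a b, orth a b = true → inner ℂ (u i a) (u i b) = 0) :
    PairwiseOrthogonal fun l => productVec fun i => u i (word l i) := by
  intro l m hlm
  obtain ⟨i, hi⟩ := exists_orth_of_ne l m hlm
  rw [inner_productVec]
  exact Finset.prod_eq_zero (Finset.mem_univ i) (hu i _ _ hi)

theorem isOrthogonalSet_halder : IsOrthogonalSet halder := by
  refine ⟨fun l h => ?_, pairwiseOrthogonal_productVec (u := fun _ => letterHalder)
    fun _ a b h => by rw [inner_letterHalder, pair₁_one_eq_zero h, mul_zero]⟩
  have h' : inner ℂ (halder l) (halder l) = 0 := by rw [h, inner_zero_left]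
  rw [halder, inner_productVec] at h'
  obtain ⟨i, -, hi⟩ := Finset.prod_eq_zero_iff.1 h'
  rw [inner_letterHalder] at hi
  refine mul_ne_zero (mul_ne_zero (halderFactor_ne_zero _) (halderFactor_ne_zero _))
    (pair₁_one_ne_zero ?_) hi
  cases word l i <;> simp [orth]

/-! ### Invariance under protocols -/

section Irreducibility

variable {β : Type} [Fintype β]

/-- `A` is a nonzero multiple of an isometry. -/
def IsScaledIsometry {γ δ : Type} [Fintype γ] [DecidableEq δ] (A : Matrix γ δ ℂ) : Prop :=
  ∃ a : ℂ, a ≠ 0 ∧ Aᴴ * A = a • 1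

/-- `φ` arises from the model set by a scaled isometry on party `i`, a joint scaled isometry on the
other two parties, and nonzero scalar factors. -/
def IsBlockCopy (i : Fin 3) (φ : Label → Space (Fin 3) β) : Prop :=
  ∃ (A : Matrix β (Fin 3) ℂ) (B : Matrix (β × β) (Fin 3 × Fin 3) ℂ) (c : Label → ℂ),
    IsScaledIsometry A ∧ IsScaledIsometry B ∧ (∀ l, c l ≠ 0) ∧
      ∀ l, φ l = c l • act (blockOp i A B) (halder l)

theorem inner_blockCopy (i : Fin 3) {A : Matrix β (Fin 3) ℂ}
    {B : Matrix (β × β) (Fin 3 × Fin 3) ℂ} {a b : ℂ} {E : Matrix (Fin 3) (Fin 3) ℂ}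
    {F : Matrix (Fin 3 × Fin 3) (Fin 3 × Fin 3) ℂ} (hA : Aᴴ * A = a • E) (hB : Bᴴ * B = b • F)
    (k k' : ℂ) (l m : Label) :
    inner ℂ (k • act (blockOp i A B) (halder l)) (k' • act (blockOp i A B) (halder m)) =
      star k * k' * (a * b) * inner ℂ (halder l) (act (blockOp i E F) (halder m)) := by
  rw [inner_smul_left, inner_smul_right, inner_act_act, blockOp_conjTranspose, blockOp_mul, hA, hB,
    blockOp_smul_smul, smul_act, inner_smul_right]
  simp only [starRingEnd_apply]
  ring

theorem IsBlockCopy.isOrthogonalSet {i : Fin 3} {φ : Label → Space (Fin 3) β}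
    (h : IsBlockCopy i φ) : IsOrthogonalSet φ := by
  obtain ⟨A, B, c, ⟨a, ha, hA⟩, ⟨b, hb, hB⟩, hc, hφ⟩ := h
  have hin : ∀ l m, inner ℂ (φ l) (φ m) =
      star (c l) * c m * (a * b) * inner ℂ (halder l) (halder m) := by
    intro l m
    rw [hφ, hφ, inner_blockCopy i hA hB, blockOp_one, act_one]
  refine ⟨fun l h => ?_, fun l m hlm => ?_⟩
  · have h' := hin l l
    rw [h, inner_zero_left] at h'
    refine mul_ne_zero (mul_ne_zero (mul_ne_zero ?_ (hc l)) (mul_ne_zero ha hb)) ?_ h'.symm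
    · exact star_ne_zero.2 (hc l)
    · exact inner_self_ne_zero.2 (isOrthogonalSet_halder.1 l)
  · exact (hin l m).trans (by rw [isOrthogonalSet_halder.2 hlm, mul_zero])

variable [DecidableEq β]

open scoped ComplexOrder in
/-- The invariant of a protocol with groups inside `{i}` and `{i}ᶜ`: if the measuring party or pair
has brought `A` to `A'`, then `A'ᴴ * A'` keeps the model set orthogonal, so it is a scalar. If that
scalar is `0` the outcome occurs for none of the states, and otherwise `A'` is again a scaled
isometry. -/
theorem IsBlockCopy.eq_zero_or_postState [Nonempty β] {i : Fin 3} {φ : Label → Space (Fin 3) β}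
    (h : IsBlockCopy i φ) {S : Finset (Fin 3)} (hS : S = {i} ∨ i ∉ S)
    (N : Matrix (S → β) (S → β) ℂ) (hN : PairwiseOrthogonal (postState S N φ)) :
    postState S N φ = 0 ∨ IsBlockCopy i (postState S N φ) := by
  obtain ⟨A, B, c, ⟨a, ha, hA⟩, ⟨b, hb, hB⟩, hc, hφ⟩ := h
  rcases hS with rfl | hS
  · have hpost : ∀ l, postState {i} N φ l = c l • act (blockOp i
        (Matrix.of (fun x y => N (fun _ => x) (fun _ => y)) * A) B) (halder l) := by
      intro l
      rw [postState, hφ, act_smul, act_act, localOp_singleton, blockOp_mul, Matrix.one_mul]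
    generalize (Matrix.of (fun x y => N (fun _ => x) (fun _ => y)) * A) = A' at hpost
    have hE := eq_scalar_of_orthogonal_left i (E := A'ᴴ * A') fun l m hlm => by
      have : inner ℂ (postState _ N φ l) (postState _ N φ m) = 0 := hN hlm
      rw [hpost, hpost, inner_blockCopy i (one_smul ℂ _).symm hB] at this
      exact (mul_eq_zero.1 this).resolve_left (mul_ne_zero (mul_ne_zero
        (star_ne_zero.2 (hc l)) (hc m)) (mul_ne_zero one_ne_zero hb))
    by_cases he : (A'ᴴ * A') 0 0 = 0
    · left
      rw [he, zero_smul, Matrix.conjTranspose_mul_self_eq_zero] at hE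
      funext l
      have h0 : blockOp i (0 : Matrix β (Fin 3) ℂ) B = 0 := by ext; simp [blockOp]
      simp [hpost, hE, h0, act]
    · exact .inr ⟨A', B, c, ⟨_, he, hE⟩, ⟨b, hb, hB⟩, hc, hpost⟩
  · obtain ⟨Y, hY⟩ := exists_localOp_eq_blockOp hS N
    have hpost : ∀ l, postState S N φ l = c l • act (blockOp i A (Y * B)) (halder l) := by
      intro l
      rw [postState, hφ, act_smul, act_act, hY, blockOp_mul, Matrix.one_mul]
    generalize Y * B = B' at hpost
    have hF := eq_scalar_of_orthogonal_right i (F := B'ᴴ * B') fun l m hlm => by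
      have : inner ℂ (postState _ N φ l) (postState _ N φ m) = 0 := hN hlm
      rw [hpost, hpost, inner_blockCopy i hA (one_smul ℂ _).symm] at this
      exact (mul_eq_zero.1 this).resolve_left (mul_ne_zero (mul_ne_zero
        (star_ne_zero.2 (hc l)) (hc m)) (mul_ne_zero ha one_ne_zero))
    by_cases he : (B'ᴴ * B') (0, 0) (0, 0) = 0
    · left
      rw [he, zero_smul, Matrix.conjTranspose_mul_self_eq_zero] at hF
      funext l
      have h0 : blockOp i A (0 : Matrix (β × β) (Fin 3 × Fin 3) ℂ) = 0 := by ext; simp [blockOp]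
      simp [hpost, hF, h0, act]
    · exact .inr ⟨A, B', c, ⟨a, ha, hA⟩, ⟨_, he, hF⟩, hc, hpost⟩

theorem IsBlockCopy.locallyIrreducible [Nonempty β] {i : Fin 3} {φ : Label → Space (Fin 3) β}
    (h : IsBlockCopy i φ) {𝒮 : Set (Finset (Fin 3))} (h𝒮 : ∀ S ∈ 𝒮, S = {i} ∨ i ∉ S) :
    LocallyIrreducible 𝒮 φ := by
  refine ⟨h.isOrthogonalSet, fun χ hχ => ?_⟩
  have key : χ = 0 ∨ IsBlockCopy i χ := by
    induction hχ with
    | start => exact .inr h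
    | step M k hS _ hM ih =>
      rcases ih with rfl | ih
      · exact .inl (funext fun l => act_zero _)
      · exact ih.eq_zero_or_postState (h𝒮 _ hS) _ (hM.2 k)
  rintro ⟨⟨l, hl⟩, m, hm⟩
  rcases key with rfl | hc
  · exact hm rfl
  · exact hc.isOrthogonalSet.1 l hl

theorem IsLocalCopy.isBlockCopy {V : Fin 3 → Matrix β (Fin 3) ℂ} {φ : Label → Space (Fin 3) β}
    (h : IsLocalCopy V halder φ) (i : Fin 3) : IsBlockCopy i φ := by
  obtain ⟨hV, c, hc, hφ⟩ := h
  refine ⟨V i, V (i + 1) ⊗ₖ V (i + 2), c, ⟨1, one_ne_zero, ?_⟩, ⟨1, one_ne_zero, ?_⟩, hc, ?_⟩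
  · rw [hV, one_smul]
  · rw [Matrix.conjTranspose_kronecker, ← Matrix.mul_kronecker_mul, hV, hV,
      Matrix.one_kronecker_one, one_smul]
  · intro l
    rw [hφ, tensorOp_eq_blockOp i]

theorem IsLocalCopy.locallyIrreducible_separated [Nonempty β] {V : Fin 3 → Matrix β (Fin 3) ℂ}
    {φ : Label → Space (Fin 3) β} (h : IsLocalCopy V halder φ) :
    LocallyIrreducible (separated (Fin 3)) φ := by
  refine (h.isBlockCopy 0).locallyIrreducible ?_
  rintro _ ⟨j, rfl⟩
  by_cases hj : j = 0
  · exact .inl (by rw [hj])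
  · exact .inr (by simpa using Ne.symm hj)

theorem IsLocalCopy.locallyIrreducible_allBut [Nonempty β] {V : Fin 3 → Matrix β (Fin 3) ℂ}
    {φ : Label → Space (Fin 3) β} (h : IsLocalCopy V halder φ) (i : Fin 3) :
    LocallyIrreducible (allBut i) φ := by
  refine (h.isBlockCopy i).locallyIrreducible ?_
  rintro _ (rfl | rfl)
  · exact .inl rfl
  · exact .inr (by simp)

end Irreducibility

theorem isLocalCopy_halder : IsLocalCopy (fun _ => 1) halder halder := by
  refine ⟨fun i => by simp, 1, fun _ => one_ne_zero, fun l => ?_⟩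
  have : tensorOp (fun _ : Fin 3 => (1 : Matrix (Fin 3) (Fin 3) ℂ)) = 1 := by
    rw [tensorOp_eq_blockOp 0, Matrix.one_kronecker_one, blockOp_one]
  rw [this, act_one, Pi.one_apply, one_smul]

/-! ### The measurements on `ℂ⁶` -/

/-- Functions on the one-element set `{i}`, evaluated at `i`. Along it `onParty i K` is a reindexing
of `K`. -/
def singletonFunEquiv {P α : Type} [DecidableEq P] (i : P) :
    (({i} : Finset P) → α) ≃ α where
  toFun x := x ⟨i, Finset.mem_singleton_self i⟩
  invFun a := fun _ => a
  left_inv x := by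
    funext ⟨j, hj⟩
    obtain rfl := Finset.mem_singleton.1 hj
    rfl
  right_inv _ := rfl

theorem isMeasurement_onParty {P α κ : Type} [Fintype P] [DecidableEq P] [Fintype α]
    [DecidableEq α] [Fintype κ] (i : P) {K : κ → Matrix α α ℂ} (hK : IsMeasurement K) :
    IsMeasurement fun k => onParty i (K k) := by
  have h : ∀ k, onParty i (K k) = (K k).submatrix (singletonFunEquiv i) (singletonFunEquiv i) :=
    fun _ => rfl
  simp only [IsMeasurement, h, Matrix.conjTranspose_submatrix, Matrix.submatrix_mul_equiv] at *
  rw [← Matrix.submatrix_one_equiv (singletonFunEquiv i), ← hK]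
  ext x y
  simp [Matrix.sum_apply]

theorem postState_onParty_productVec {α L : Type} [Fintype α] [DecidableEq α] (i : Fin 3)
    (K : Matrix α α ℂ) (a : L → Fin 3 → EuclideanSpace ℂ α) :
    postState {i} (onParty i K) (fun l => productVec (a l)) =
      fun l => productVec fun j => if j = i then act K (a l j) else a l j := by
  have h : localOp {i} (onParty i K) = tensorOp fun j => if j = i then K else 1 := by
    rw [localOp_singleton, tensorOp_eq_blockOp i, if_pos rfl, if_neg (by fin_cases i <;> decide),
      if_neg (by fin_cases i <;> decide), Matrix.one_kronecker_one]
    rfl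
  funext l
  rw [postState, h, act_tensorOp_productVec]
  congr 1
  funext j
  split_ifs
  · rfl
  · exact act_one _

theorem isMeasurement_proj : IsMeasurement proj := by
  rw [IsMeasurement, Fin.sum_univ_two]
  ext x y
  fin_cases x <;> fin_cases y <;> simp [proj, Matrix.diagonal_conjTranspose]

theorem act_proj_act_proj (k : Fin 2) (v : EuclideanSpace ℂ (Fin 6)) :
    act (proj k) (act (proj k) v) = act (proj k) v := by
  rw [act_act]
  congr 1
  ext x y
  fin_cases k <;> fin_cases x <;> fin_cases y <;> simp [proj]

theorem embed_conjTranspose_mul_embed (k : Fin 2) : (embed k)ᴴ * embed k = 1 := by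
  ext x y
  fin_cases k <;> fin_cases x <;> fin_cases y <;>
    simp [embed, pqr, Matrix.mul_apply]

/-- The scalar by which the projected letter of `ℂ⁶` exceeds the embedded letter of `ℂ³`: a sign,
or the `√2` that the normalised `η` and `κ` lack. -/
noncomputable def copyFactor (k : Fin 2) : Letter → ℂ
  | .eta _ | .kappa _ => (Real.sqrt 2 : ℝ)
  | _ => ![1, -1] k

theorem copyFactor_ne_zero (k : Fin 2) (a : Letter) : copyFactor k a ≠ 0 := by
  fin_cases k <;> cases a <;> simp [copyFactor]

theorem act_proj_letterG3 (k : Fin 2) (a : Letter) :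
    act (proj k) (letterG3 a) = copyFactor k a • act (embed k) (letterHalder a) := by
  ext x
  fin_cases k <;> rcases a with _ | _ | _ | s | s <;> fin_cases x <;>
    simp [act, proj, letterG3, copyFactor, embed, letterHalder, pqr, ket, Matrix.mulVec, dotProduct,
      Fin.sum_univ_succ]

theorem inner_act_proj_letterG3 (k : Fin 2) {a b : Letter} (h : orth a b = true) :
    inner ℂ (act (proj k) (letterG3 a)) (act (proj k) (letterG3 b)) = 0 := by
  rw [act_proj_letterG3, act_proj_letterG3, inner_smul_left, inner_smul_right, inner_act_act,
    embed_conjTranspose_mul_embed, act_one, inner_letterHalder, pair₁_one_eq_zero h]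
  simp

/-- Orthogonality of the full letters is the sum of that of the two projected parts. -/
theorem inner_letterG3 {a b : Letter} (h : orth a b = true) :
    inner ℂ (letterG3 a) (letterG3 b) = 0 := by
  have h0 := inner_act_proj_letterG3 0 h
  have h1 := inner_act_proj_letterG3 1 h
  rw [inner_act_act] at h0 h1
  have hm := isMeasurement_proj
  rw [IsMeasurement, Fin.sum_univ_two] at hm
  have hs : inner ℂ _ _ + inner ℂ _ _ = (0 + 0 : ℂ) := congrArg₂ (· + ·) h0 h1
  rwa [← inner_add_right, ← add_act, hm, act_one, add_zero] at hs

theorem letterG3_ne_zero (a : Letter) : letterG3 a ≠ 0 := by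
  intro h
  have h' : ∀ x, letterG3 a x = 0 := fun x => by rw [h]; rfl
  rcases a with _ | _ | _ | s | s
  · simpa [letterG3, ket] using h' 0
  · simpa [letterG3, ket] using h' 1
  · simpa [letterG3, ket] using h' 2
  · simpa [letterG3, ket] using h' 0
  · simpa [letterG3, ket] using h' 0

theorem isOrthogonalSet_G3 : IsOrthogonalSet G3 := by
  refine ⟨fun l h => ?_, pairwiseOrthogonal_productVec (u := fun _ => letterG3)
    fun _ _ _ h => inner_letterG3 h⟩
  have h' : inner ℂ (G3 l) (G3 l) = 0 := by rw [h, inner_zero_left]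
  rw [G3, inner_productVec] at h'
  obtain ⟨i, -, hi⟩ := Finset.prod_eq_zero_iff.1 h'
  exact letterG3_ne_zero _ (inner_self_eq_zero.1 hi)

/-- The letter `a` in the hands of party `i`, after the parties in `t` have obtained the outcomes
`o`. Repetitions in `t` do not matter, since the measurement operators are projectors. -/
noncomputable def measuredLetter (o : Fin 3 → Fin 2) (t : List (Fin 3)) (i : Fin 3) (a : Letter) :
    EuclideanSpace ℂ (Fin 6) :=
  if i ∈ t then act (proj (o i)) (letterG3 a) else letterG3 a

theorem measured_eq_productVec (o : Fin 3 → Fin 2) (t : List (Fin 3)) :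
    measured o t = fun l => productVec fun i => measuredLetter o t i (word l i) := by
  induction t with
  | nil => funext l; simp [measured, measuredLetter, G3]
  | cons i t ih =>
    rw [measured, ih, postState_onParty_productVec]
    funext l
    congr 1
    funext j
    by_cases hji : j = i
    · subst hji
      by_cases hj : j ∈ t <;> simp [measuredLetter, hj, act_proj_act_proj]
    · simp [measuredLetter, hji]

theorem pairwiseOrthogonal_measured (o : Fin 3 → Fin 2) (t : List (Fin 3)) :
    PairwiseOrthogonal (measured o t) := by
  rw [measured_eq_productVec]
  refine pairwiseOrthogonal_productVec fun i a b h => ?_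
  by_cases hi : i ∈ t
  · simpa only [measuredLetter, if_pos hi] using inner_act_proj_letterG3 _ h
  · simpa only [measuredLetter, if_neg hi] using inner_letterG3 h

theorem isLocalOPM_measured (o : Fin 3 → Fin 2) {t : List (Fin 3)} {i : Fin 3} (hi : i ∉ t) :
    IsLocalOPM {i} (fun k => onParty i (proj k)) (measured o t) := by
  refine ⟨isMeasurement_onParty i isMeasurement_proj, fun k => ?_⟩
  -- Party `i` has not measured yet, so `o i` may be replaced by the outcome `k` in question.
  have h : measured o t = measured (Function.update o i k) t := by
    rw [measured_eq_productVec, measured_eq_productVec]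
    funext l
    congr 1
    funext j
    by_cases hj : j ∈ t
    · have hji : j ≠ i := fun h => hi (h ▸ hj)
      simp [measuredLetter, hj, hji]
    · simp [measuredLetter, hj]
  have h' := pairwiseOrthogonal_measured (Function.update o i k) (i :: t)
  rwa [measured, ← h, Function.update_self] at h'

theorem isLocalCopy_measured (o : Fin 3 → Fin 2) {t : List (Fin 3)} (ht : ∀ i, i ∈ t) :
    IsLocalCopy (fun i => embed (o i)) halder (measured o t) := by
  refine ⟨fun i => embed_conjTranspose_mul_embed _, fun l => ∏ i, copyFactor (o i) (word l i),
    fun l => Finset.prod_ne_zero_iff.2 fun i _ => copyFactor_ne_zero _ _, fun l => ?_⟩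
  simp only [measured_eq_productVec, measuredLetter, ht, if_true, act_proj_letterG3, halder,
    act_tensorOp_productVec, productVec_smul]

end ActivatedNonlocality

theorem theorem3 :
    -- the 27 states are nonzero and mutually orthogonal
    ActivatedNonlocality.IsOrthogonalSet ActivatedNonlocality.G3 ∧
    -- in whatever order the parties measure, each of the measurements is a local OPM
    (∀ (o : Fin 3 → Fin 2) (t : List (Fin 3)) (i : Fin 3), (i :: t).Nodup →
      ActivatedNonlocality.IsLocalOPM {i}
        (fun k => ActivatedNonlocality.onParty i (ActivatedNonlocality.proj k))
        (ActivatedNonlocality.measured o t)) ∧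
    -- each of the eight outcome branches, once all the parties have measured
    (∀ (o : Fin 3 → Fin 2) (t : List (Fin 3)), t.Nodup → (∀ i, i ∈ t) →
      ActivatedNonlocality.IsLocalCopy (fun i => ActivatedNonlocality.embed (o i))
        ActivatedNonlocality.halder (ActivatedNonlocality.measured o t) ∧
      (∀ l, ActivatedNonlocality.IsProductVec (ActivatedNonlocality.measured o t l)) ∧
      ActivatedNonlocality.LocallyIrreducible (ActivatedNonlocality.separated (Fin 3))
        (ActivatedNonlocality.measured o t) ∧
      ∀ i, ActivatedNonlocality.LocallyIrreducible (ActivatedNonlocality.allBut i)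
        (ActivatedNonlocality.measured o t)) ∧
    -- the model set in dimension 3 ⊗ 3 ⊗ 3
    ActivatedNonlocality.LocallyIrreducible (ActivatedNonlocality.separated (Fin 3))
      ActivatedNonlocality.halder ∧
    ∀ i, ActivatedNonlocality.LocallyIrreducible (ActivatedNonlocality.allBut i)
      ActivatedNonlocality.halder := by
  open ActivatedNonlocality in
  refine ⟨isOrthogonalSet_G3, fun o t i h => isLocalOPM_measured o (List.nodup_cons.1 h).1,
    fun o t _ ht => ?_, isLocalCopy_halder.locallyIrreducible_separated,
    isLocalCopy_halder.locallyIrreducible_allBut⟩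
  have h := ActivatedNonlocality.isLocalCopy_measured o ht
  refine ⟨h, fun l => ?_, h.locallyIrreducible_separated, h.locallyIrreducible_allBut⟩
  rw [ActivatedNonlocality.measured_eq_productVec]
  exact ⟨_, rfl⟩
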